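/- Let $(R,\mathfrak m)$ be a commutative Noetherian local ring with residue field $k=R/\mathfrak m$, let $E=E(R/\mathfrak m)$ be an injective hull of $k$ as an $R$-module, $\widehat R$ the $\mathfrak m$-adic completion of $R$, and $K$ the total quotient ring of $R$ (the localization of $R$ at the set of all its non-zero-divisors). An $R$-module $M$ is called divisible if $rM=M$ for every non-zero-divisor $r\in R$, and simple divisible if $M\neq 0$ is divisible but no submodule $U$ with $0\neq U\subsetneq M$ is divisible. Every element of $E$ is annihilated by a power of $\mathfrak m$, so $E$ is canonically an $\widehat R$-module; for an $R$-submodule $N\subseteq E$ let $\operatorname{Ann}_{\widehat R}(N)=\{u\in\widehat R : uN=0\}$. Then $$N\;\longmapsto\;\operatorname{Ann}_{\widehat R}(N)\cdot(\widehat R\otimes_R K),$$ the ideal generated by the image of $\operatorname{Ann}_{\widehat R}(N)$ under $u\mapsto u\otimes 1$, is a bijection from the set of simple divisible $R$-submodules $N$ of $E$ onto the set of maximal ideals of the ring $\widehat R\otimes_R K$. In particular, $E$ itself is simple divisible as an $R$-module if and only if $\widehat R\otimes_R K$ is a field. -/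

import Mathlib

open scoped TensorProduct

universe u v

/-- An `R`-module `M` is divisible if `r M = M` for every non-zero-divisor `r` of `R`. -/
def IsDivisibleModule (R : Type*) [CommRing R] (M : Type*) [AddCommGroup M] [Module R M] : Prop :=
  ∀ r ∈ nonZeroDivisors R, ∀ y : M, ∃ x : M, r • x = y

/-- A module is simple divisible if it is nonzero and divisible, and no nonzero proper submodule
is divisible. -/
structure IsSimpleDivisible (R : Type*) [CommRing R] (M : Type*) [AddCommGroup M] [Module R M] :
    Prop where
  nontrivial : Nontrivial M
  divisible : IsDivisibleModule R M
  not_divisible : ∀ U : Submodule R M, U ≠ ⊥ → U ≠ ⊤ → ¬ IsDivisibleModule R U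

/-- The linear map `i : M → E` exhibits `E` as an injective hull of `M`: it is injective, `E` is an
injective module, and `E` is an essential extension of the image of `i`. -/
structure IsInjectiveHull {R : Type*} [CommRing R] {M E : Type*} [AddCommGroup M] [Module R M]
    [AddCommGroup E] [Module R E] (i : M →ₗ[R] E) : Prop where
  injective_map : Function.Injective i
  injective_module : Module.Injective R E
  essential : ∀ U : Submodule R E, U ≠ ⊥ → U ⊓ LinearMap.range i ≠ ⊥

/-- Every element of `E` is annihilated by some power of the ideal `I`. -/
def IsIdealPowTorsion {R : Type*} [CommRing R] (I : Ideal R) (E : Type*) [AddCommGroup E]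
    [Module R E] : Prop :=
  ∀ x : E, ∃ n : ℕ, ∀ r ∈ I ^ n, r • x = 0

section CompletionAction

variable {R : Type*} [CommRing R] {I : Ideal R} {E : Type*} [AddCommGroup E] [Module R E]

/-- `u • x` for `u` in the completion: if `I ^ n` kills `x`, then `u` acts as any element of `R`
congruent to `u` modulo `I ^ n`. -/
noncomputable def completionSMul (h : IsIdealPowTorsion I E) (u : AdicCompletion I R) (x : E) : E :=
  (Ideal.Quotient.mk_surjective (AdicCompletion.evalₐ I (h x).choose u)).choose • x

theorem completionSMul_eq (h : IsIdealPowTorsion I E) (u : AdicCompletion I R) (x : E) {n : ℕ}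
    (hn : ∀ r ∈ I ^ n, r • x = 0) {r : R}
    (hr : Ideal.Quotient.mk (I ^ n) r = AdicCompletion.evalₐ I n u) :
    completionSMul h u x = r • x := by
  have key : ∀ (a b : ℕ), a ≤ b → (∀ r ∈ I ^ a, r • x = 0) → ∀ s t : R,
      Ideal.Quotient.mk (I ^ a) s = AdicCompletion.evalₐ I a u →
      Ideal.Quotient.mk (I ^ b) t = AdicCompletion.evalₐ I b u → s • x = t • x := by
    intro a b hab ha s t hs ht
    have h1 : Ideal.Quotient.mk (I ^ a) t = AdicCompletion.evalₐ I a u := by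
      obtain ⟨f, rfl⟩ := AdicCompletion.mk_surjective I R u
      rw [AdicCompletion.evalₐ_mk] at ht ⊢
      refine Eq.trans ?_ (AdicCompletion.Ideal.mk_eq_mk I hab f)
      exact Ideal.Quotient.eq.mpr (Ideal.pow_le_pow_right hab (Ideal.Quotient.eq.mp ht))
    have h2 : s - t ∈ I ^ a := Ideal.Quotient.eq.mp (hs.trans h1.symm)
    have h3 := ha _ h2
    rwa [sub_smul, sub_eq_zero] at h3
  have hc := (h x).choose_spec
  have hs := (Ideal.Quotient.mk_surjective (AdicCompletion.evalₐ I (h x).choose u)).choose_spec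
  unfold completionSMul
  rcases le_total (h x).choose n with hle | hle
  · exact key _ _ hle hc _ _ hs hr
  · exact (key _ _ hle hn _ _ hr hs).symm

theorem exists_common_pow_torsion (h : IsIdealPowTorsion I E) (x y : E) :
    ∃ n : ℕ, (∀ r ∈ I ^ n, r • x = 0) ∧ ∀ r ∈ I ^ n, r • y = 0 := by
  obtain ⟨a, ha⟩ := h x
  obtain ⟨b, hb⟩ := h y
  exact ⟨max a b, fun r hr => ha r (Ideal.pow_le_pow_right (le_max_left a b) hr),
    fun r hr => hb r (Ideal.pow_le_pow_right (le_max_right a b) hr)⟩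

/-- The canonical module structure over the `I`-adic completion on an `I`-power torsion module,
as an algebra homomorphism to the endomorphism ring. -/
noncomputable def completionAction (h : IsIdealPowTorsion I E) :
    AdicCompletion I R →ₐ[R] Module.End R E where
  toFun u :=
    { toFun := completionSMul h u
      map_add' := fun x y => by
        obtain ⟨n, hx, hy⟩ := exists_common_pow_torsion h x y
        obtain ⟨r, hr⟩ := Ideal.Quotient.mk_surjective (AdicCompletion.evalₐ I n u)
        have hxy : ∀ s ∈ I ^ n, s • (x + y) = 0 := fun s hs => by
          rw [smul_add, hx s hs, hy s hs, add_zero]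
        rw [completionSMul_eq h u x hx hr, completionSMul_eq h u y hy hr,
          completionSMul_eq h u (x + y) hxy hr, smul_add]
      map_smul' := fun a x => by
        obtain ⟨n, hx⟩ := h x
        obtain ⟨r, hr⟩ := Ideal.Quotient.mk_surjective (AdicCompletion.evalₐ I n u)
        have hax : ∀ s ∈ I ^ n, s • (a • x) = 0 := fun s hs => by
          rw [smul_comm, hx s hs, smul_zero]
        rw [completionSMul_eq h u x hx hr, completionSMul_eq h u (a • x) hax hr, smul_comm]
        rfl }
  map_one' := LinearMap.ext fun x => by
    obtain ⟨n, hx⟩ := h x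
    have := completionSMul_eq h 1 x hx (r := 1) (by rw [map_one, map_one])
    simpa using this
  map_mul' u w := LinearMap.ext fun x => by
    obtain ⟨n, hx⟩ := h x
    obtain ⟨r, hr⟩ := Ideal.Quotient.mk_surjective (AdicCompletion.evalₐ I n u)
    obtain ⟨s, hs⟩ := Ideal.Quotient.mk_surjective (AdicCompletion.evalₐ I n w)
    have hsx : ∀ t ∈ I ^ n, t • (s • x) = 0 := fun t ht => by
      rw [smul_comm, hx t ht, smul_zero]
    change completionSMul h (u * w) x = completionSMul h u (completionSMul h w x)
    rw [completionSMul_eq h w x hx hs, completionSMul_eq h u _ hsx hr,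
      completionSMul_eq h (u * w) x hx (r := r * s) (by rw [map_mul, map_mul, hr, hs]), mul_smul]
  map_zero' := LinearMap.ext fun x => by
    obtain ⟨n, hx⟩ := h x
    have := completionSMul_eq h 0 x hx (r := 0) (by rw [map_zero, map_zero])
    simpa using this
  map_add' u w := LinearMap.ext fun x => by
    obtain ⟨n, hx⟩ := h x
    obtain ⟨r, hr⟩ := Ideal.Quotient.mk_surjective (AdicCompletion.evalₐ I n u)
    obtain ⟨s, hs⟩ := Ideal.Quotient.mk_surjective (AdicCompletion.evalₐ I n w)
    change completionSMul h (u + w) x = completionSMul h u x + completionSMul h w x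
    rw [completionSMul_eq h w x hx hs, completionSMul_eq h u x hx hr,
      completionSMul_eq h (u + w) x hx (r := r + s) (by rw [map_add, map_add, hr, hs]), add_smul]
  commutes' a := LinearMap.ext fun x => by
    obtain ⟨n, hx⟩ := h x
    have := completionSMul_eq h (algebraMap R _ a) x hx (r := a) (by
      rw [AlgHom.commutes]; rfl)
    simpa using this

/-- The annihilator of an `R`-submodule `N` of `E` in the `I`-adic completion of `R`. -/
noncomputable def completionAnnihilator (h : IsIdealPowTorsion I E) (N : Submodule R E) :
    Ideal (AdicCompletion I R) where
  carrier := {u | ∀ x ∈ N, completionAction h u x = 0}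
  zero_mem' := fun x _ => by rw [map_zero]; rfl
  add_mem' := fun ha hb x hx => by
    rw [map_add, LinearMap.add_apply, ha x hx, hb x hx, add_zero]
  smul_mem' := fun c u hu x hx => by
    rw [smul_eq_mul, map_mul, Module.End.mul_apply, hu x hx, map_zero]

end CompletionAction

/-- The injective hull of the residue field of a Noetherian local ring is power torsion with respect
to the maximal ideal, hence carries the canonical module structure over the completion. -/
theorem IsInjectiveHull.isIdealPowTorsion {R : Type*} [CommRing R] [IsLocalRing R]
    [IsNoetherianRing R] {E : Type*} [AddCommGroup E] [Module R E]
    {i : IsLocalRing.ResidueField R →ₗ[R] E} (hi : IsInjectiveHull i) :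
    IsIdealPowTorsion (IsLocalRing.maximalIdeal R) E := by
  intro x
  have hrad : IsLocalRing.maximalIdeal R ≤ (Submodule.span R {x}).annihilator.radical := by
    intro r hr
    let f : ℕ →o Ideal R :=
      { toFun := fun n => (Submodule.span R {r ^ n • x}).annihilator
        monotone' := monotone_nat_of_le_succ fun n a ha => by
          rw [Submodule.mem_annihilator_span_singleton] at ha ⊢
          rw [pow_succ', mul_smul, smul_comm, ha, smul_zero] }
    obtain ⟨n, hn⟩ := monotone_stabilizes_iff_noetherian.mpr ‹IsNoetherianRing R› f
    refine ⟨n, ?_⟩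
    rw [Submodule.mem_annihilator_span_singleton]
    by_contra hne
    have hU : Submodule.span R {r ^ n • x} ≠ ⊥ := by
      rwa [Ne, Submodule.span_singleton_eq_bot]
    obtain ⟨z, hz, hz0⟩ := Submodule.exists_mem_ne_zero_of_ne_bot (hi.essential _ hU)
    obtain ⟨⟨s, hs⟩, ⟨c, hc⟩⟩ := And.imp_left Submodule.mem_span_singleton.mp hz
    have hrz : r • z = 0 := by
      rw [← hc, ← map_smul, Algebra.smul_def, IsLocalRing.ResidueField.algebraMap_eq,
        (IsLocalRing.residue_eq_zero_iff r).mpr hr, zero_mul, map_zero]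
    have hmem : s ∈ f (n + 1) := by
      change s ∈ (Submodule.span R {r ^ (n + 1) • x}).annihilator
      rw [Submodule.mem_annihilator_span_singleton, pow_succ', mul_smul, smul_comm, hs, hrz]
    rw [← hn (n + 1) (Nat.le_succ n)] at hmem
    have := (Submodule.mem_annihilator_span_singleton _ _).mp hmem
    exact hz0 (hs ▸ this)
  obtain ⟨n, hn⟩ := Ideal.exists_pow_le_of_le_radical_of_fg hrad (IsNoetherian.noetherian _)
  exact ⟨n, fun r hr => (Submodule.mem_annihilator_span_singleton _ _).mp (hn hr)⟩

/-! Matlis duality does the work. Taking annihilators is an inclusion-reversing bijection between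
the `R`-submodules of `E` and the ideals of the completion. One composite is the identity because
`E` is a cogenerator and each of its endomorphisms is multiplication by an element of the completion
(`completionAction_surjective`). The other is because ideals of the completion are closed. Divisible
submodules correspond to ideals saturated with respect to the non-zero-divisors of `R`
(`isDivisibleModule_submodule_iff`), which are exactly the ideals contracted from the localization
`S ⊗[R] K` of the completion `S`. Minimal nonzero divisible submodules thus match maximal ideals of
that localization. Finally, `E` is itself divisible and corresponds to the zero ideal. -/

section Noetherian

/-! ### The completion is Noetherian and its ideals are closed. -/

/-- A power series ring over `R` in finitely many variables maps onto the completion of `R` at a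
finitely generated ideal. -/
theorem AdicCompletion.isNoetherianRing {R : Type*} [CommRing R] [IsNoetherianRing R]
    (I : Ideal R) : IsNoetherianRing (AdicCompletion I R) := by
  obtain ⟨s, hs⟩ := I.fg_of_isNoetherianRing
  set S := AdicCompletion I R
  set M : Ideal S := I.map (algebraMap R S)
  have hM : IsAdicComplete M S := AdicCompletion.isAdicComplete_self I I.fg_of_isNoetherianRing
  let : WithIdeal S := ⟨M⟩
  -- The discrete topology makes the coefficient map continuous; power series can then be evaluated
  -- at the generators of `I`, which are topologically nilpotent in `S`.
  let : UniformSpace R := ⊥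
  have : DiscreteUniformity R := ⟨rfl⟩
  have hadic : IsAdic M := rfl
  obtain ⟨h1, h2⟩ := hadic.isAdicComplete_iff.mp hM
  let a : s → S := fun x => algebraMap R S x
  have ha : MvPowerSeries.HasEval a :=
    { hpow := fun x => WithIdeal.isTopologicallyNilpotent_of_mem
        (Ideal.mem_map_of_mem _ (hs ▸ Ideal.subset_span x.2))
      tendsto_zero := by rw [Filter.cofinite_eq_bot]; exact Filter.tendsto_bot }
  have hφ : Continuous (algebraMap R S) := continuous_of_discreteTopology
  let F : MvPowerSeries s R →+* S := MvPowerSeries.eval₂Hom hφ ha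
  have hFX : ∀ x, F (MvPowerSeries.X x) = a x := fun x => by
    simp [F, MvPowerSeries.coe_eval₂Hom, MvPowerSeries.eval₂_X]
  have hFC : ∀ r, F (MvPowerSeries.C r) = algebraMap R S r := fun r => by
    simp [F, MvPowerSeries.coe_eval₂Hom, MvPowerSeries.eval₂_C]
  have hmap : (Ideal.span (Set.range MvPowerSeries.X) : Ideal (MvPowerSeries s R)).map F = M := by
    rw [Ideal.map_span, ← Set.range_comp]
    refine Eq.trans ?_ ((Ideal.map_span _ _).symm.trans (congrArg (Ideal.map (algebraMap R S)) hs))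
    congr 1
    ext y
    simp [hFX, a]
  have hsurj : Function.Surjective F := by
    have : IsHausdorff
        ((Ideal.span (Set.range MvPowerSeries.X) : Ideal (MvPowerSeries s R)).map F) S := by
      rw [hmap]; infer_instance
    -- By completeness, surjectivity modulo `M` suffices, and constants already cover `S ⧸ M`, which
    -- is `R ⧸ I`.
    refine surjective_of_mk_map_comp_surjective
      (I := Ideal.span (Set.range MvPowerSeries.X)) F ?_
    intro y
    obtain ⟨y, rfl⟩ := Ideal.Quotient.mk_surjective y
    obtain ⟨r, hr⟩ := Ideal.Quotient.mk_surjective (AdicCompletion.evalOneₐ I y)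
    refine ⟨MvPowerSeries.C r, ?_⟩
    rw [RingHom.comp_apply, hFC, Ideal.Quotient.eq, hmap]
    change _ ∈ I.map (algebraMap R S)
    rw [← AdicCompletion.ker_evalOneₐ_eq_map I I.fg_of_isNoetherianRing, RingHom.mem_ker]
    change AdicCompletion.evalOneₐ I _ = 0
    rw [map_sub, sub_eq_zero, ← hr]
    exact AdicCompletion.evalOneₐ_of I r
  exact isNoetherianRing_of_surjective _ _ F hsurj

open IsLocalRing

/-- Ideals of the completion of a Noetherian local ring are closed. -/
theorem AdicCompletion.mem_of_forall_mem_sup_ker {R : Type*} [CommRing R] [IsLocalRing R]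
    [IsNoetherianRing R] (b : Ideal (AdicCompletion (maximalIdeal R) R))
    {u : AdicCompletion (maximalIdeal R) R}
    (hu : ∀ n, ∃ w ∈ b, AdicCompletion.evalₐ _ n u = AdicCompletion.evalₐ _ n w) : u ∈ b := by
  have := AdicCompletion.isNoetherianRing (maximalIdeal R)
  rw [← Submodule.Quotient.mk_eq_zero b]
  -- Krull's intersection theorem for the finite module `S ⧸ b` over a Noetherian local ring.
  refine (inferInstance : IsHausdorff (maximalIdeal (AdicCompletion (maximalIdeal R) R))
    (AdicCompletion (maximalIdeal R) R ⧸ b)).haus _ fun n => ?_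
  obtain ⟨w, hw, huw⟩ := hu n
  rw [SModEq.zero, ← sub_zero (Submodule.Quotient.mk u),
    ← (Submodule.Quotient.mk_eq_zero b).mpr hw, ← Submodule.Quotient.mk_sub]
  have hk : u - w ∈ maximalIdeal (AdicCompletion (maximalIdeal R) R) ^ n := by
    rw [AdicCompletion.maximalIdeal_eq_map, ← Ideal.map_pow]
    have h1 : u - w ∈ (AdicCompletion.eval (maximalIdeal R) R n).ker := by
      rw [LinearMap.mem_ker, AdicCompletion.eval_apply]
      have := AdicCompletion.factor_evalₐ_eq_eval (maximalIdeal R) (n := n) (u - w) (by simp)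
      rw [map_sub, huw, sub_self, _root_.map_zero] at this
      exact this.symm
    rw [← AdicCompletion.pow_smul_top_eq_ker_eval (maximalIdeal R).fg_of_isNoetherianRing,
      Ideal.smul_top_eq_map] at h1
    exact h1
  have := Submodule.smul_mem_smul hk (Submodule.mem_top (x := (Submodule.Quotient.mk 1 :
    AdicCompletion (maximalIdeal R) R ⧸ b)))
  rwa [← Submodule.Quotient.mk_smul, smul_eq_mul, mul_one] at this

end Noetherian

namespace IsInjectiveHull

/-! ### Socle and cogenerator property of the injective hull. -/

section Cogenerator

variable {R : Type u} [CommRing R] [IsLocalRing R] {E : Type u} [AddCommGroup E] [Module R E]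
  {i : IsLocalRing.ResidueField R →ₗ[R] E}

/-- The socle of `E` is the copy of the residue field: essentiality puts a nonzero multiple of `x`
in the image, and its coefficient must be a unit. -/
theorem mem_range_of_smul_eq_zero (hi : IsInjectiveHull i) {x : E}
    (hx : ∀ r ∈ IsLocalRing.maximalIdeal R, r • x = 0) : x ∈ LinearMap.range i := by
  rcases eq_or_ne x 0 with rfl | hx0
  · exact zero_mem _
  obtain ⟨z, hz, hz0⟩ := Submodule.exists_mem_ne_zero_of_ne_bot
    (hi.essential (Submodule.span R {x}) (by rwa [Ne, Submodule.span_singleton_eq_bot]))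
  obtain ⟨s, rfl⟩ := Submodule.mem_span_singleton.mp hz.1
  have hs : IsUnit s := by
    by_contra h
    exact hz0 (hx s ((IsLocalRing.mem_maximalIdeal s).mpr h))
  obtain ⟨s, rfl⟩ := hs
  have := Submodule.smul_mem _ ((s⁻¹ : Rˣ) : R) hz.2
  rwa [smul_smul, Units.inv_mul, one_smul] at this

/-- The cyclic module generated by `y` surjects onto the residue field; injectivity of `E` extends
the resulting map to `M`. -/
theorem exists_linearMap_ne_zero (hi : IsInjectiveHull i) {M : Type u} [AddCommGroup M]
    [Module R M] {y : M} (hy : y ≠ 0) : ∃ f : M →ₗ[R] E, f y ≠ 0 := by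
  let t := LinearMap.toSpanSingleton R M y
  have ht : LinearMap.ker t ≤ LinearMap.ker (i ∘ₗ Algebra.linearMap R _) := by
    intro r hr
    have hrm : r ∈ IsLocalRing.maximalIdeal R := by
      rw [IsLocalRing.mem_maximalIdeal]
      intro hu
      refine hy ((hu.smul_eq_zero).mp ?_)
      simpa [t] using hr
    rw [LinearMap.mem_ker, LinearMap.comp_apply, Algebra.linearMap_apply,
      IsLocalRing.ResidueField.algebraMap_eq, (IsLocalRing.residue_eq_zero_iff r).mpr hrm, map_zero]
  have hinj : Function.Injective ((LinearMap.ker t).liftQ t le_rfl) := by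
    rw [← LinearMap.ker_eq_bot]
    exact Submodule.ker_liftQ_eq_bot _ _ _ le_rfl
  obtain ⟨f, hf⟩ := hi.injective_module.out _ hinj ((LinearMap.ker t).liftQ _ ht)
  refine ⟨f, fun h0 => ?_⟩
  have h1 := hf (Submodule.Quotient.mk 1)
  rw [Submodule.liftQ_apply, Submodule.liftQ_apply] at h1
  simp only [t, LinearMap.toSpanSingleton_apply, one_smul, h0, LinearMap.comp_apply,
    Algebra.linearMap_apply, map_one] at h1
  exact one_ne_zero (hi.injective_map (h1.symm.trans (map_zero i).symm))

theorem exists_smul_ne_zero (hi : IsInjectiveHull i) {I : Ideal R} {a : R} (ha : a ∉ I) :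
    ∃ x : E, (∀ r ∈ I, r • x = 0) ∧ a • x ≠ 0 := by
  obtain ⟨f, hf⟩ := hi.exists_linearMap_ne_zero (M := R ⧸ I) (y := Ideal.Quotient.mk I a)
    (by rwa [Ne, Ideal.Quotient.eq_zero_iff_mem])
  have key : ∀ r : R, r • f 1 = f (Ideal.Quotient.mk I r) := fun r => by
    rw [← map_smul, Algebra.smul_def, mul_one]; rfl
  refine ⟨f 1, fun r hr => ?_, by rwa [key]⟩
  rw [key, Ideal.Quotient.eq_zero_iff_mem.mpr hr, map_zero]

theorem isDivisibleModule (hi : IsInjectiveHull i) : IsDivisibleModule R E := by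
  intro r hr y
  have hinj : Function.Injective (LinearMap.toSpanSingleton R R r) := by
    intro a b hab
    exact (mul_cancel_right_mem_nonZeroDivisors hr).mp (by simpa using hab)
  obtain ⟨f, hf⟩ := hi.injective_module.out _ hinj (LinearMap.toSpanSingleton R E y)
  refine ⟨f 1, ?_⟩
  have := hf 1
  simp only [LinearMap.toSpanSingleton_apply, one_smul] at this
  rw [← map_smul, smul_eq_mul, mul_one, this]

end Cogenerator

/-! ### Endomorphisms of the injective hull. -/

section Duality

variable {R : Type u} [CommRing R] [IsLocalRing R] [IsNoetherianRing R]
  {E : Type u} [AddCommGroup E] [Module R E] {i : IsLocalRing.ResidueField R →ₗ[R] E}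

open IsLocalRing

/-- On the part of `E` killed by an `m`-primary ideal, every endomorphism of `E` acts as an element
of `R`. -/
theorem exists_eq_smul_of_pow_le (hi : IsInjectiveHull i) (f : E →ₗ[R] E) (I : Ideal R) :
    ∀ n, maximalIdeal R ^ n ≤ I → ∃ r : R, ∀ x, (∀ a ∈ I, a • x = 0) → f x = r • x := by
  induction I using WellFoundedGT.induction with
  | ind I ih =>
  intro n hn
  by_cases htop : I = ⊤
  · refine ⟨0, fun x hx => ?_⟩
    have h0 : x = 0 := by simpa using hx 1 (htop ▸ Submodule.mem_top)
    rw [h0, map_zero, smul_zero]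
  -- A socle element of `R ⧸ I`, taken from the last power of the maximal ideal not contained in
  -- `I`; induction applies to `I + (a)`.
  obtain ⟨a, haI, ham⟩ : ∃ a, a ∉ I ∧ ∀ t ∈ maximalIdeal R, t * a ∈ I := by
    classical
    have hex : ∃ n, maximalIdeal R ^ n ≤ I := ⟨n, hn⟩
    have hpos : Nat.find hex ≠ 0 := fun h0 => by
      have := Nat.find_spec hex
      rw [h0, pow_zero, Ideal.one_eq_top, top_le_iff] at this
      exact htop this
    obtain ⟨k, hk⟩ := Nat.exists_eq_succ_of_ne_zero hpos
    obtain ⟨a, ha, haI⟩ := Set.not_subset.mp (Nat.find_min hex (m := k) (by omega))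
    refine ⟨a, haI, fun t ht => Nat.find_spec hex ?_⟩
    rw [hk, pow_succ']
    exact Ideal.mul_mem_mul ht ha
  have hlt : I < I ⊔ Ideal.span {a} :=
    lt_of_le_of_ne le_sup_left fun h =>
      haI (h ▸ Ideal.mem_sup_right (Ideal.mem_span_singleton_self a))
  obtain ⟨r, hr⟩ := ih _ hlt n (hn.trans hlt.le)
  have hkill : ∀ x, (∀ b ∈ I, b • x = 0) → a • x = 0 → f x = r • x := fun x hx hax => by
    refine hr x fun b hb => ?_
    obtain ⟨c, hc, d, hd, rfl⟩ := Submodule.mem_sup.mp hb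
    obtain ⟨e, rfl⟩ := Ideal.mem_span_singleton'.mp hd
    rw [add_smul, hx c hc, mul_smul, hax, smul_zero, add_zero]
  obtain ⟨x₀, hx₀, hax₀⟩ := hi.exists_smul_ne_zero haI
  have hsoc : ∀ x, (∀ b ∈ I, b • x = 0) → a • x ∈ LinearMap.range i := fun x hx =>
    hi.mem_range_of_smul_eq_zero fun t ht => by rw [smul_smul]; exact hx _ (ham t ht)
  have hmul : ∀ z ∈ LinearMap.range i, ∃ t : R, z = t • a • x₀ := by
    rintro _ ⟨e, rfl⟩
    obtain ⟨c, hc⟩ := hsoc x₀ hx₀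
    have hc0 : c ≠ 0 := by
      rintro rfl
      exact hax₀ (by rw [← hc, map_zero])
    obtain ⟨t, ht⟩ := residue_surjective (e / c)
    refine ⟨t, ?_⟩
    rw [← hc, ← map_smul, Algebra.smul_def, ResidueField.algebraMap_eq, ht, div_mul_cancel₀ _ hc0]
  -- The error of `r` at `x₀` lies in the socle, which `a • x₀` spans, so adding `s * a` to `r`
  -- corrects it. Any other `x` killed by `I` differs from a multiple of `x₀` by something killed by
  -- `I + (a)`, where `r` is already right.
  obtain ⟨s, hs⟩ := hmul (f x₀ - r • x₀) <| hi.mem_range_of_smul_eq_zero fun t ht => by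
    rw [smul_sub, ← map_smul, hkill (t • x₀) (fun b hb => by rw [smul_comm, hx₀ b hb, smul_zero])
      (by rw [smul_smul, mul_comm]; exact hx₀ _ (ham t ht)), smul_comm, sub_self]
  refine ⟨r + s * a, fun x hx => ?_⟩
  obtain ⟨t, ht⟩ := hmul _ (hsoc x hx)
  have h1 := hkill (x - t • x₀)
    (fun b hb => by rw [smul_sub, hx b hb, smul_comm, hx₀ b hb, smul_zero, sub_zero])
    (by rw [smul_sub, ht, smul_comm, sub_self])
  rw [map_sub, map_smul, sub_eq_iff_eq_add] at h1
  rw [h1, eq_add_of_sub_eq hs, add_smul, mul_smul, ht]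
  simp only [smul_sub, smul_add, smul_comm t]
  abel

/-- Every endomorphism of the injective hull of the residue field is given by an element of the
completion. -/
theorem completionAction_surjective (hi : IsInjectiveHull i) :
    Function.Surjective (completionAction hi.isIdealPowTorsion) := by
  intro f
  choose r hr using fun n => hi.exists_eq_smul_of_pow_le f (maximalIdeal R ^ n) n le_rfl
  -- `r n - r (n + 1)` kills everything in `E` killed by the `n`th power, so the cogenerator
  -- property puts it in that power.
  have hcauchy : ∀ n, r n ≡ r (n + 1) [SMOD (maximalIdeal R ^ n • ⊤ : Submodule R R)] := by
    intro n
    rw [SModEq.sub_mem, smul_eq_mul, Ideal.mul_top]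
    by_contra hn
    obtain ⟨x, hx, hne⟩ := hi.exists_smul_ne_zero hn
    refine hne ?_
    rw [sub_smul, ← hr n x hx,
      ← hr (n + 1) x fun a ha => hx a (Ideal.pow_le_pow_right n.le_succ ha), sub_self]
  refine ⟨AdicCompletion.mk _ R (AdicCompletion.AdicCauchySequence.mk _ R r hcauchy), ?_⟩
  ext x
  obtain ⟨n, hn⟩ := hi.isIdealPowTorsion x
  rw [hr n x hn]
  exact completionSMul_eq _ _ _ hn (by rw [AdicCompletion.evalₐ_mk]; rfl)

/-- A map from `E ⧸ N` to `E` not vanishing at `x` gives an endomorphism of `E`, hence an element of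
the completion that kills `N` but not `x`. -/
theorem mem_of_completionAnnihilator (hi : IsInjectiveHull i) (N : Submodule R E) {x : E}
    (hx : ∀ u ∈ completionAnnihilator hi.isIdealPowTorsion N,
      completionAction hi.isIdealPowTorsion u x = 0) : x ∈ N := by
  by_contra hxN
  obtain ⟨f, hf⟩ := hi.exists_linearMap_ne_zero (M := E ⧸ N) (y := N.mkQ x)
    (by rwa [Ne, Submodule.mkQ_apply, Submodule.Quotient.mk_eq_zero])
  obtain ⟨u, hu⟩ := hi.completionAction_surjective (f ∘ₗ N.mkQ)
  refine hf ?_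
  rw [← LinearMap.comp_apply, ← hu]
  refine hx u fun y hy => ?_
  rw [hu, LinearMap.comp_apply, Submodule.mkQ_apply, (Submodule.Quotient.mk_eq_zero N).mpr hy,
    map_zero]

end Duality

end IsInjectiveHull

/-! ### The annihilator correspondence and divisibility. -/

/-- The submodule of `E` annihilated by an ideal of the completion. -/
noncomputable def completionTorsion {R : Type*} [CommRing R] {I : Ideal R} {E : Type*}
    [AddCommGroup E] [Module R E] (h : IsIdealPowTorsion I E) (b : Ideal (AdicCompletion I R)) :
    Submodule R E :=
  ⨅ u ∈ b, LinearMap.ker (completionAction h u)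

theorem mem_completionTorsion {R : Type*} [CommRing R] {I : Ideal R} {E : Type*} [AddCommGroup E]
    [Module R E] (h : IsIdealPowTorsion I E) {b : Ideal (AdicCompletion I R)} {x : E} :
    x ∈ completionTorsion h b ↔ ∀ u ∈ b, completionAction h u x = 0 := by
  simp [completionTorsion]

theorem completionAnnihilator_anti {R : Type*} [CommRing R] {I : Ideal R} {E : Type*}
    [AddCommGroup E] [Module R E] (h : IsIdealPowTorsion I E) {N N' : Submodule R E}
    (hN : N ≤ N') : completionAnnihilator h N' ≤ completionAnnihilator h N :=
  fun _ hu x hx => hu x (hN hx)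

theorem completionTorsion_anti {R : Type*} [CommRing R] {I : Ideal R} {E : Type*}
    [AddCommGroup E] [Module R E] (h : IsIdealPowTorsion I E) {b c : Ideal (AdicCompletion I R)}
    (hb : b ≤ c) : completionTorsion h c ≤ completionTorsion h b := fun x hx => by
  rw [mem_completionTorsion] at hx ⊢
  exact fun u hu => hx u (hb hu)

namespace IsInjectiveHull

variable {R : Type u} [CommRing R] [IsLocalRing R] [IsNoetherianRing R]
  {E : Type u} [AddCommGroup E] [Module R E] {i : IsLocalRing.ResidueField R →ₗ[R] E}

open IsLocalRing

theorem completionTorsion_completionAnnihilator (hi : IsInjectiveHull i) (N : Submodule R E) :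
    completionTorsion hi.isIdealPowTorsion (completionAnnihilator hi.isIdealPowTorsion N) = N := by
  refine le_antisymm (fun x hx => ?_) fun x hx => ?_
  · exact hi.mem_of_completionAnnihilator N ((mem_completionTorsion _).mp hx)
  · exact (mem_completionTorsion _).mpr fun u hu => hu x hx

/-- Closedness of `b` reduces the claim to each quotient by a power of the maximal ideal, where the
cogenerator property over `R` separates `u` from `b`. -/
theorem completionAnnihilator_completionTorsion (hi : IsInjectiveHull i)
    (b : Ideal (AdicCompletion (maximalIdeal R) R)) :
    completionAnnihilator hi.isIdealPowTorsion (completionTorsion hi.isIdealPowTorsion b) = b := by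
  refine le_antisymm (fun u hu => ?_) fun u hu x hx => (mem_completionTorsion _).mp hx u hu
  refine AdicCompletion.mem_of_forall_mem_sup_ker b fun n => ?_
  by_contra! hne
  let φ := AdicCompletion.evalₐ (maximalIdeal R) n
  -- `I` contains the `n`th power, so on elements killed by `I` the completion acts through `R`, and
  -- `b` acts as zero.
  let I : Ideal R := (b.map φ).comap (Ideal.Quotient.mk (maximalIdeal R ^ n))
  obtain ⟨r, hr⟩ := Ideal.Quotient.mk_surjective (φ u)
  have hmem : ∀ {s : R}, s ∈ I ↔ ∃ w ∈ b, φ w = Ideal.Quotient.mk _ s :=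
    Ideal.mem_map_iff_of_surjective φ (AdicCompletion.surjective_evalₐ _ n)
  have hrI : r ∉ I := fun h => by
    obtain ⟨w, hw, hwr⟩ := hmem.mp h
    exact hne w hw (hr.symm.trans hwr.symm)
  obtain ⟨x, hx, hrx⟩ := hi.exists_smul_ne_zero hrI
  have hxn : ∀ s ∈ maximalIdeal R ^ n, s • x = 0 := fun s hs => hx s <| hmem.mpr
    ⟨0, zero_mem _, by rw [map_zero, Ideal.Quotient.eq_zero_iff_mem.mpr hs]⟩
  refine hrx ?_
  rw [← completionSMul_eq hi.isIdealPowTorsion u x hxn hr]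
  refine hu x ((mem_completionTorsion _).mpr fun w hw => ?_)
  obtain ⟨s, hs⟩ := Ideal.Quotient.mk_surjective (φ w)
  exact (completionSMul_eq _ w x hxn hs).trans (hx s (hmem.mpr ⟨w, hw, hs.symm⟩))

/-- A submodule of `E` is divisible if and only if every non-zero-divisor of `R` is a
non-zero-divisor modulo its annihilator in the completion. -/
theorem isDivisibleModule_submodule_iff (hi : IsInjectiveHull i) (N : Submodule R E) :
    IsDivisibleModule R N ↔ ∀ r ∈ nonZeroDivisors R, ∀ u,
      algebraMap R _ r * u ∈ completionAnnihilator hi.isIdealPowTorsion N →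
        u ∈ completionAnnihilator hi.isIdealPowTorsion N := by
  have key : ∀ (r : R) u x, completionAction hi.isIdealPowTorsion (algebraMap R _ r * u) x =
      completionAction hi.isIdealPowTorsion u (r • x) := fun r u x => by
    rw [mul_comm, map_mul, AlgHom.commutes, Module.End.mul_apply, Module.algebraMap_end_apply]
  constructor
  · intro h r hr u hu x hx
    obtain ⟨y, hy⟩ := h r hr ⟨x, hx⟩
    have := hu y y.2
    rwa [key, ← Submodule.coe_smul, hy] at this
  · intro h r hr y
    -- Duality applied to `r • N`: if `u` kills it, then `r * u` kills `N`, so `u` kills `N` by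
    -- saturation.
    have : (y : E) ∈ N.map (LinearMap.lsmul R E r) := by
      refine hi.mem_of_completionAnnihilator _ fun u hu => ?_
      refine h r hr u (fun x hx => ?_) y y.2
      rw [key]
      exact hu _ ⟨x, hx, rfl⟩
    obtain ⟨x, hx, hxy⟩ := this
    exact ⟨⟨x, hx⟩, Subtype.ext hxy⟩

end IsInjectiveHull

/-! ### Minimality inside `E`, and saturated ideals of a localization. -/

theorem IsDivisibleModule.of_linearEquiv {R M M' : Type*} [CommRing R] [AddCommGroup M]
    [Module R M] [AddCommGroup M'] [Module R M'] (e : M ≃ₗ[R] M') (h : IsDivisibleModule R M) :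
    IsDivisibleModule R M' := fun r hr y => by
  obtain ⟨x, hx⟩ := h r hr (e.symm y)
  exact ⟨e x, by rw [← map_smul, hx, e.apply_symm_apply]⟩

/-- Minimality expressed among submodules of `E`, the form that the order-reversing correspondence
can transport. -/
theorem isSimpleDivisible_submodule_iff {R E : Type*} [CommRing R] [AddCommGroup E] [Module R E]
    (N : Submodule R E) : IsSimpleDivisible R N ↔ N ≠ ⊥ ∧ IsDivisibleModule R N ∧
      ∀ U ≤ N, U ≠ ⊥ → IsDivisibleModule R U → U = N := by
  constructor
  · refine fun h => ⟨(Submodule.nontrivial_iff_ne_bot).mp h.nontrivial, h.divisible,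
      fun U hUN hU hdiv => ?_⟩
    by_contra hne
    refine h.not_divisible (U.submoduleOf N) (fun h0 => hU ?_) (fun h0 => hne ?_)
      (hdiv.of_linearEquiv (Submodule.submoduleOfEquivOfLe hUN).symm)
    · rw [← inf_eq_right.mpr hUN, ← Submodule.map_comap_subtype]
      exact (congrArg _ h0).trans (Submodule.map_bot _)
    · exact le_antisymm hUN (Submodule.submoduleOf_eq_top.mp h0)
  · rintro ⟨h0, hdiv, h⟩
    refine ⟨(Submodule.nontrivial_iff_ne_bot).mpr h0, hdiv, fun U hU hU' hUdiv => hU' ?_⟩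
    have := h (U.map N.subtype) (Submodule.map_subtype_le N U)
      (fun h0 => hU (Submodule.map_injective_of_injective N.injective_subtype
        (h0.trans (Submodule.map_bot _).symm)))
      (hUdiv.of_linearEquiv (Submodule.equivMapOfInjective _ N.injective_subtype U))
    refine Submodule.map_injective_of_injective N.injective_subtype ?_
    rw [this, Submodule.map_subtype_top]

theorem isSimpleDivisible_top_iff {R E : Type*} [CommRing R] [AddCommGroup E] [Module R E] :
    IsSimpleDivisible R (⊤ : Submodule R E) ↔ IsSimpleDivisible R E := by
  rw [isSimpleDivisible_submodule_iff]
  constructor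
  · rintro ⟨h0, hdiv, h⟩
    exact ⟨(Submodule.nontrivial_iff R).mp ⟨⟨⊥, ⊤, h0.symm⟩⟩,
      hdiv.of_linearEquiv Submodule.topEquiv, fun U hU hU' hUdiv => hU' (h U le_top hU hUdiv)⟩
  · rintro ⟨h0, hdiv, h⟩
    refine ⟨top_ne_bot, hdiv.of_linearEquiv Submodule.topEquiv.symm, fun U _ hU hUdiv => ?_⟩
    by_contra hU'
    exact h U hU hU' hUdiv

/-- Clearing denominators gives `t * (w * u) ∈ b` with `t` and `w` in `W`; saturation cancels both.
-/
theorem under_map_of_saturated {A B : Type*} [CommRing A] [CommRing B] [Algebra A B]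
    (W : Submonoid A) [IsLocalization W B] {b : Ideal A}
    (hb : ∀ w ∈ W, ∀ u, w * u ∈ b → u ∈ b) : (b.map (algebraMap A B)).under A = b := by
  refine le_antisymm (fun u hu => ?_) Ideal.le_comap_map
  obtain ⟨⟨c, w⟩, hc⟩ := (IsLocalization.mem_map_algebraMap_iff W B).mp (Ideal.mem_comap.mp hu)
  rw [← map_mul] at hc
  obtain ⟨t, ht⟩ := (IsLocalization.eq_iff_exists W B).mp hc
  refine hb w w.2 u (hb t t.2 _ ?_)
  rw [mul_comm (w : A), ht]
  exact Ideal.mul_mem_left _ _ c.2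

theorem saturated_under {A B : Type*} [CommRing A] [CommRing B] [Algebra A B]
    (W : Submonoid A) [IsLocalization W B] (J : Ideal B) {w u : A} (hw : w ∈ W)
    (h : w * u ∈ J.under A) : u ∈ J.under A := by
  rw [Ideal.under_def, Ideal.mem_comap, map_mul] at h
  exact (Ideal.unit_mul_mem_iff_mem J (IsLocalization.map_units B (⟨w, hw⟩ : W))).mp h

/-! ### Simple divisible submodules and maximal ideals. -/

section Correspondence

variable {R : Type u} [CommRing R] [IsLocalRing R] [IsNoetherianRing R]
  (K : Type v) [CommRing K] [Algebra R K] [IsFractionRing R K]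
  {E : Type u} [AddCommGroup E] [Module R E] {i : IsLocalRing.ResidueField R →ₗ[R] E}

open IsLocalRing

local notation "S" => AdicCompletion (maximalIdeal R) R

theorem IsInjectiveHull.under_map_completionAnnihilator (hi : IsInjectiveHull i)
    {N : Submodule R E} (hN : IsDivisibleModule R N) :
    ((completionAnnihilator hi.isIdealPowTorsion N).map (algebraMap S (S ⊗[R] K))).under S =
      completionAnnihilator hi.isIdealPowTorsion N := by
  refine under_map_of_saturated (Algebra.algebraMapSubmonoid S (nonZeroDivisors R)) ?_
  rintro _ ⟨r, hr, rfl⟩ u hu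
  exact (hi.isDivisibleModule_submodule_iff N).mp hN r hr u hu

theorem IsInjectiveHull.isDivisibleModule_completionTorsion_under (hi : IsInjectiveHull i)
    (J : Ideal (S ⊗[R] K)) :
    IsDivisibleModule R (completionTorsion hi.isIdealPowTorsion (J.under S)) := by
  rw [hi.isDivisibleModule_submodule_iff, hi.completionAnnihilator_completionTorsion]
  intro r hr u hu
  exact saturated_under (Algebra.algebraMapSubmonoid S (nonZeroDivisors R)) J
    (Algebra.mem_algebraMapSubmonoid_of_mem (⟨r, hr⟩ : nonZeroDivisors R)) hu

theorem IsInjectiveHull.completionAnnihilator_ne_top (hi : IsInjectiveHull i)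
    {N : Submodule R E} (hN : N ≠ ⊥) : completionAnnihilator hi.isIdealPowTorsion N ≠ ⊤ := by
  intro h
  refine hN (eq_bot_iff.mpr fun x hx => ?_)
  have h1 := (Ideal.eq_top_iff_one _).mp h x hx
  rwa [map_one] at h1

theorem IsInjectiveHull.completionTorsion_ne_bot (hi : IsInjectiveHull i) {b : Ideal S}
    (hb : b ≠ ⊤) : completionTorsion hi.isIdealPowTorsion b ≠ ⊥ := by
  intro h
  refine hb ?_
  rw [← hi.completionAnnihilator_completionTorsion b, h, Ideal.eq_top_iff_one]
  intro x hx
  rw [(Submodule.mem_bot R).mp hx, map_zero]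

theorem IsInjectiveHull.isMaximal_map_completionAnnihilator (hi : IsInjectiveHull i)
    {N : Submodule R E} (hN : IsSimpleDivisible R N) :
    ((completionAnnihilator hi.isIdealPowTorsion N).map (algebraMap S (S ⊗[R] K))).IsMaximal := by
  obtain ⟨h0, hdiv, h⟩ := (isSimpleDivisible_submodule_iff N).mp hN
  have hunder := hi.under_map_completionAnnihilator K hdiv
  refine ⟨⟨fun htop => hi.completionAnnihilator_ne_top h0 ?_, fun J hJ => ?_⟩⟩
  · rw [← hunder, htop]
    exact Ideal.comap_top
  by_contra hJtop
  -- A proper ideal `J` above the image contracts to the annihilator of a nonzero divisible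
  -- submodule of `N`, which must be `N`; this forces equality.
  have hU : completionTorsion hi.isIdealPowTorsion (J.under S) = N := by
    refine h _ ?_ (hi.completionTorsion_ne_bot fun htop => hJtop (Ideal.comap_eq_top_iff.mp htop))
      (hi.isDivisibleModule_completionTorsion_under K J)
    rw [← hi.completionTorsion_completionAnnihilator N]
    exact completionTorsion_anti _ (Ideal.map_le_iff_le_comap.mp hJ.le)
  refine hJ.ne ?_
  rw [← hU, hi.completionAnnihilator_completionTorsion,
    IsLocalization.map_under (Algebra.algebraMapSubmonoid S (nonZeroDivisors R))]

theorem IsInjectiveHull.isSimpleDivisible_completionTorsion_under (hi : IsInjectiveHull i)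
    {J : Ideal (S ⊗[R] K)} (hJ : J.IsMaximal) :
    IsSimpleDivisible R (completionTorsion hi.isIdealPowTorsion (J.under S)) := by
  have hJtop : J.under S ≠ ⊤ := fun h => hJ.ne_top (Ideal.comap_eq_top_iff.mp h)
  refine (isSimpleDivisible_submodule_iff _).mpr ⟨hi.completionTorsion_ne_bot hJtop,
    hi.isDivisibleModule_completionTorsion_under K J, fun U hU hU0 hUdiv => ?_⟩
  have hunder := hi.under_map_completionAnnihilator K hUdiv
  have hle : J ≤ (completionAnnihilator hi.isIdealPowTorsion U).map
      (algebraMap S (S ⊗[R] K)) := by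
    rw [← IsLocalization.map_under (Algebra.algebraMapSubmonoid S (nonZeroDivisors R)) _ J,
      ← hi.completionAnnihilator_completionTorsion (J.under S)]
    exact Ideal.map_mono (completionAnnihilator_anti _ hU)
  have heq := hJ.eq_of_le (fun htop => hi.completionAnnihilator_ne_top hU0 <| by
    rw [← hunder, htop]
    exact Ideal.comap_top) hle
  rw [heq, hunder, hi.completionTorsion_completionAnnihilator]

theorem IsInjectiveHull.bijOn_map_completionAnnihilator (hi : IsInjectiveHull i) :
    Set.BijOn (fun N : Submodule R E =>
        (completionAnnihilator hi.isIdealPowTorsion N).map (algebraMap S (S ⊗[R] K)))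
      {N : Submodule R E | IsSimpleDivisible R N} {M : Ideal (S ⊗[R] K) | M.IsMaximal} := by
  refine ⟨fun N hN => hi.isMaximal_map_completionAnnihilator K hN, fun N hN N' hN' h => ?_,
    fun J hJ => ⟨_, hi.isSimpleDivisible_completionTorsion_under K hJ, ?_⟩⟩
  · rw [← hi.completionTorsion_completionAnnihilator N,
      ← hi.completionTorsion_completionAnnihilator N',
      ← hi.under_map_completionAnnihilator K hN.divisible,
      ← hi.under_map_completionAnnihilator K hN'.divisible]
    exact congrArg (fun J => completionTorsion hi.isIdealPowTorsion (Ideal.under S J)) h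
  · simp only [hi.completionAnnihilator_completionTorsion]
    exact IsLocalization.map_under (Algebra.algebraMapSubmonoid S (nonZeroDivisors R)) _ J

theorem IsInjectiveHull.completionAnnihilator_top (hi : IsInjectiveHull i) :
    completionAnnihilator hi.isIdealPowTorsion (⊤ : Submodule R E) = ⊥ := by
  rw [← hi.completionAnnihilator_completionTorsion ⊥]
  congr 1
  refine (eq_top_iff.mpr fun x _ => (mem_completionTorsion _).mpr fun u hu => ?_).symm
  rw [(Submodule.mem_bot _).mp hu, map_zero, LinearMap.zero_apply]

theorem IsInjectiveHull.isSimpleDivisible_iff_isField (hi : IsInjectiveHull i) :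
    IsSimpleDivisible R E ↔ IsField (S ⊗[R] K) := by
  have hbij := hi.bijOn_map_completionAnnihilator K
  rw [← isSimpleDivisible_top_iff]
  constructor
  · intro h
    have hmax := hi.isMaximal_map_completionAnnihilator K h
    rw [hi.completionAnnihilator_top, Ideal.map_bot] at hmax
    have : Nontrivial (S ⊗[R] K) := (Submodule.nontrivial_iff _).mp ⟨⟨⊥, ⊤, hmax.ne_top⟩⟩
    exact Ring.isField_iff_maximal_bot.mpr hmax
  · intro h
    have := h.nontrivial
    -- The zero ideal, being maximal, comes from some simple divisible `N`. Divisibility of `E`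
    -- shows that this ideal contracts to the annihilator of `E`, so `N = ⊤` by duality.
    obtain ⟨N, hN, hN0⟩ := hbij.surjOn (Ring.isField_iff_maximal_bot.mp h)
    have hdiv : IsDivisibleModule R (⊤ : Submodule R E) :=
      hi.isDivisibleModule.of_linearEquiv Submodule.topEquiv.symm
    have htop := hi.under_map_completionAnnihilator K hdiv
    rw [hi.completionAnnihilator_top, Ideal.map_bot] at htop
    have hann := hi.under_map_completionAnnihilator K hN.divisible
    change Ideal.map (algebraMap S (S ⊗[R] K)) _ = _ at hN0
    rw [hN0, htop, ← hi.completionAnnihilator_top] at hann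
    have : N = ⊤ := by
      rw [← hi.completionTorsion_completionAnnihilator N, ← hann,
        hi.completionTorsion_completionAnnihilator]
    exact this ▸ hN

end Correspondence
theorem mainTheorem2 {R : Type u} [CommRing R] [IsLocalRing R] [IsNoetherianRing R]
    {K : Type v} [CommRing K] [Algebra R K] [IsFractionRing R K]
    {E : Type u} [AddCommGroup E] [Module R E]
    {i : IsLocalRing.ResidueField R →ₗ[R] E} (hi : IsInjectiveHull i) :
    Set.BijOn
      (fun N : Submodule R E =>
        (completionAnnihilator hi.isIdealPowTorsion N).map
          (Algebra.TensorProduct.includeLeft :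
            AdicCompletion (IsLocalRing.maximalIdeal R) R →ₐ[R]
              AdicCompletion (IsLocalRing.maximalIdeal R) R ⊗[R] K))
      {N : Submodule R E | IsSimpleDivisible R N}
      {M : Ideal (AdicCompletion (IsLocalRing.maximalIdeal R) R ⊗[R] K) | M.IsMaximal} ∧
    (IsSimpleDivisible R E ↔
      IsField (AdicCompletion (IsLocalRing.maximalIdeal R) R ⊗[R] K)) :=
  ⟨hi.bijOn_map_completionAnnihilator K, hi.isSimpleDivisible_iff_isField K⟩
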